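/- Let $X$ be a non-empty set and let $\mathcal L$ be the real vector space of all gambles on $X$, i.e. of all bounded maps $f\colon X\to\mathbb R$; real numbers are identified with constant gambles. Let $\mathcal Q$ be the set of all finite subsets of $\mathcal L$, including $\emptyset$, and write $(\lambda,\mu)>0$ for: $\lambda\ge 0$, $\mu\ge 0$ and $\lambda+\mu>0$. A set $D\subseteq\mathcal L$ is called an Archimedean set of desirable options if $0\notin D$; every $f\in\mathcal L$ with $\inf f>0$ is in $D$; $\lambda f+\mu g\in D$ for all $f,g\in D$ and all $(\lambda,\mu)>0$; and for every $f\in D$ there is a real $\epsilon>0$ with $f-\epsilon\in D$. Let $\overline{\mathbf D}_{\mathrm A}$ be the set of all such $D$. With $D\in\overline{\mathbf D}_{\mathrm A}$ associate the coherent lower prevision $\underline P_D\colon\mathcal L\to\mathbb R$, $\underline P_D(f)=\sup\{\mu\in\mathbb R: f-\mu\in D\}$, and the set $K_D=\{A\in\mathcal Q: A\cap D\neq\emptyset\}$. Give $\overline{\mathbf D}_{\mathrm A}$ the topology of pointwise convergence of the associated lower previsions, that is, the topology induced by the map $D\mapsto\underline P_D$ into $\mathbb R^{\mathcal L}$ with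 the product topology. A set $K\subseteq\mathcal Q$ is called coherent if - $A\setminus\{0\}\in K$ for all $A\in K$; - $\{0\}\notin K$; - $\{f\}\in K$ for all $f\in\mathcal L$ with $\inf f>0$; - for all $A_1,A_2\in K$ and all choices of $(\lambda_{f,g},\mu_{f,g})>0$ for $f\in A_1$, $g\in A_2$, also $\{\lambda_{f,g}f+\mu_{f,g}g: f\in A_1,\ g\in A_2\}\in K$; - if $A_1\in K$, $A_2\in\mathcal Q$ and $A_1\subseteq A_2$, then $A_2\in K$. It is called Archimedean if it is coherent and for every $A\in K$ there is a real $\epsilon>0$ with $A-\epsilon=\{f-\epsilon: f\in A\}\in K$. Theorem. A set $K\subseteq\mathcal Q$ is Archimedean if and only if there is a non-empty closed set $\mathcal D\subseteq\overline{\mathbf D}_{\mathrm A}$ such that $K=\bigcap_{D\in\mathcal D}K_D$. In that case, $\{D\in\overline{\mathbf D}_{\mathrm A}: K\subseteq K_D\}$ is the largest such set $\mathcal D$: it is non-empty and closed, it satisfies $K=\bigcap_{D\in\mathcal D}K_D$, and it includes every other such set. -/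

import Mathlib

/-- The real vector space of all gambles on `X`, i.e. of all bounded real-valued maps on `X`. -/
def gambleSpace (X : Type*) : Submodule ℝ (X → ℝ) where
  carrier := {f | ∃ C : ℝ, ∀ x, |f x| ≤ C}
  add_mem' := by
    rintro f g ⟨C, hC⟩ ⟨C', hC'⟩
    exact ⟨C + C', fun x => (abs_add_le _ _).trans (add_le_add (hC x) (hC' x))⟩
  zero_mem' := ⟨0, fun x => by simp⟩
  smul_mem' := by
    rintro c f ⟨C, hC⟩
    refine ⟨|c| * C, fun x => ?_⟩
    simpa [abs_mul] using mul_le_mul_of_nonneg_left (hC x) (abs_nonneg c)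

/-- A gamble on `X`; gambles are the options. -/
abbrev Gamble (X : Type*) : Type _ := ↥(gambleSpace X)

/-- The constant gamble that a real number is identified with. -/
def constGamble (X : Type*) (c : ℝ) : Gamble X := ⟨fun _ => c, |c|, fun _ => le_rfl⟩

/-- The positive options: the gambles `f` with `inf f > 0`. -/
def positiveGambles (X : Type*) : Set (Gamble X) := {f | 0 < ⨅ x, f.1 x}

/-- The relation `(l, m) > 0` for pairs of real numbers: `l ≥ 0`, `m ≥ 0` and `l + m > 0`. -/
def PosPair (l m : ℝ) : Prop := 0 ≤ l ∧ 0 ≤ m ∧ 0 < l + m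

/-- Coherence for a set of desirable options. -/
structure IsCoherentOptions {X : Type*} (D : Set (Gamble X)) : Prop where
  zero_notMem : (0 : Gamble X) ∉ D
  pos_subset : positiveGambles X ⊆ D
  cone : ∀ f ∈ D, ∀ g ∈ D, ∀ l m : ℝ, PosPair l m → l • f + m • g ∈ D

/-- An Archimedean set of desirable options: coherent, and satisfying the openness condition. -/
structure IsArchimedeanOptions {X : Type*} (D : Set (Gamble X)) : Prop where
  coherent : IsCoherentOptions D
  arch : ∀ f ∈ D, ∃ ε : ℝ, 0 < ε ∧ f - constGamble X ε ∈ D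

open Classical in
/-- Coherence for a set of desirable option sets. An option set is a finite (possibly empty) set
of options. -/
structure IsCoherentOptionSets {X : Type*} (K : Set (Finset (Gamble X))) : Prop where
  erase_zero : ∀ A ∈ K, A.erase 0 ∈ K
  zero_notMem : ({0} : Finset (Gamble X)) ∉ K
  pos : ∀ f ∈ positiveGambles X, ({f} : Finset (Gamble X)) ∈ K
  cone : ∀ A₁ ∈ K, ∀ A₂ ∈ K, ∀ l m : Gamble X → Gamble X → ℝ,
    (∀ f ∈ A₁, ∀ g ∈ A₂, PosPair (l f g) (m f g)) →
      (A₁ ×ˢ A₂).image (fun p => l p.1 p.2 • p.1 + m p.1 p.2 • p.2) ∈ K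
  mono : ∀ A₁ ∈ K, ∀ A₂ : Finset (Gamble X), A₁ ⊆ A₂ → A₂ ∈ K

open Classical in
/-- An Archimedean set of desirable option sets: coherent, and for each `A` in `K` there is some
`ε > 0` such that `A - ε = {f - ε | f ∈ A}` is in `K`. -/
structure IsArchimedeanOptionSets {X : Type*} (K : Set (Finset (Gamble X))) : Prop where
  coherent : IsCoherentOptionSets K
  arch : ∀ A ∈ K, ∃ ε : ℝ, 0 < ε ∧ A.image (fun f => f - constGamble X ε) ∈ K

/-- The set of desirable option sets `K_D` associated with a set of desirable options `D`. -/
def optionSetsOf {X : Type*} (D : Set (Gamble X)) : Set (Finset (Gamble X)) :=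
  {A | ∃ f ∈ A, f ∈ D}

/-- The functional `P_D(f) = sup {μ | f - μ ∈ D}` associated with `D`. It is used for Archimedean
`D` only, where the supremum is a real number by `isLUB_lowerPrevision`. -/
noncomputable def lowerPrevision {X : Type*} (D : Set (Gamble X)) (f : Gamble X) : ℝ :=
  sSup {μ : ℝ | f - constGamble X μ ∈ D}

theorem isLUB_lowerPrevision {X : Type*} [Nonempty X] {D : Set (Gamble X)}
    (hD : IsArchimedeanOptions D) (f : Gamble X) :
    IsLUB {μ : ℝ | f - constGamble X μ ∈ D} (lowerPrevision D f) := by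
  obtain ⟨C, hC⟩ := f.2
  refine isLUB_csSup ⟨-C - 1, hD.coherent.pos_subset ?_⟩ ⟨C + 1, fun μ hμ => ?_⟩
  · change (0 : ℝ) < _
    refine lt_of_lt_of_le one_pos (le_ciInf fun x => ?_)
    have := (abs_le.1 (hC x)).1
    change 1 ≤ f.1 x - (-C - 1)
    linarith
  · by_contra! h
    have hp : constGamble X μ - f ∈ positiveGambles X := by
      change (0 : ℝ) < _
      refine lt_of_lt_of_le one_pos (le_ciInf fun x => ?_)
      have := (abs_le.1 (hC x)).2
      change 1 ≤ μ - f.1 x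
      linarith
    have h0 := hD.coherent.cone _ hμ _ (hD.coherent.pos_subset hp) 1 1
      ⟨zero_le_one, zero_le_one, by norm_num⟩
    exact hD.coherent.zero_notMem (by simpa using h0)

/-- The type of all Archimedean sets of desirable options. -/
structure ArchimedeanOptions (X : Type*) where
  carrier : Set (Gamble X)
  isArchimedean : IsArchimedeanOptions carrier

/-- The topology on Archimedean sets of desirable options given by pointwise convergence of the
associated lower previsions. -/
noncomputable instance ArchimedeanOptions.topology (X : Type*) : TopologicalSpace (ArchimedeanOptions X) :=
  TopologicalSpace.induced (fun D => lowerPrevision D.carrier) Pi.topologicalSpace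

theorem ArchimedeanOptions.tendsto_iff {X ι : Type*} (D : ι → ArchimedeanOptions X)
    (E : ArchimedeanOptions X) (u : Filter ι) :
    Filter.Tendsto D u (nhds E) ↔ ∀ f : Gamble X,
      Filter.Tendsto (fun i => lowerPrevision (D i).carrier f) u
        (nhds (lowerPrevision E.carrier f)) := by
  rw [nhds_induced, Filter.tendsto_comap_iff, tendsto_pi_nhds]
  rfl

/-- The family `𝒟` of Archimedean sets of desirable options represents `K`: it is non-empty, closed,
and `K` is the intersection of the `K_D`, for `D` in `𝒟`. -/
def IsClosedRepresentation {X : Type*} (K : Set (Finset (Gamble X)))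
    (𝒟 : Set (ArchimedeanOptions X)) : Prop :=
  𝒟.Nonempty ∧ IsClosed 𝒟 ∧ K = ⋂ D ∈ 𝒟, optionSetsOf D.carrier

/-! Two facts carry the proof. Separation: if `B ∉ K` with `K` coherent, some coherent `D` has `K ⊆
K_D` and `B ∉ K_D`. Zorn gives `M ⊇ K` maximal among the coherent sets missing `B`; take `D = {f |
{f} ∈ M}`. If some `A ∈ M` had no element in `D`, maximality would put `B` into `extendBy M f` for
every `f ∈ A`; the elements of `A` can then be traded one by one for `B`, so `B ∈ M`, a
contradiction. When `K` is Archimedean, `D` may be replaced by its interior. Compactness: `D ↦ P_D`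
identifies the Archimedean sets with the coherent lower previsions, a closed subset of a product of
compact intervals. For `A ∈ K`, the continuous function `max_{f ∈ A} P_D(f)` is positive on a closed
representing family, so it has a minimum `δ > 0` there, and `δ / 2` serves as `ε` for all `D` at
once. -/

theorem constGamble_add (X : Type*) (a b : ℝ) :
    constGamble X (a + b) = constGamble X a + constGamble X b := rfl

theorem constGamble_sub (X : Type*) (a b : ℝ) :
    constGamble X (a - b) = constGamble X a - constGamble X b := rfl

theorem constGamble_mul (X : Type*) (a b : ℝ) :
    constGamble X (a * b) = a • constGamble X b := rfl

theorem constGamble_zero (X : Type*) : constGamble X 0 = 0 := rfl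

theorem mem_positiveGambles_of_le {X : Type*} [Nonempty X] {f : Gamble X} {c : ℝ} (hc : 0 < c)
    (h : ∀ x, c ≤ f.1 x) : f ∈ positiveGambles X :=
  lt_of_lt_of_le hc (le_ciInf h)

theorem exists_le_of_mem_positiveGambles {X : Type*} {f : Gamble X}
    (h : f ∈ positiveGambles X) : ∃ c : ℝ, 0 < c ∧ ∀ x, c ≤ f.1 x := by
  obtain ⟨C, hC⟩ := f.2
  refine ⟨⨅ x, f.1 x, h, fun x => ciInf_le ⟨-C, ?_⟩ x⟩
  rintro _ ⟨y, rfl⟩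
  exact (abs_le.1 (hC y)).1

theorem constGamble_mem_positiveGambles {X : Type*} [Nonempty X] {c : ℝ} (hc : 0 < c) :
    constGamble X c ∈ positiveGambles X :=
  mem_positiveGambles_of_le hc fun _ => le_rfl

theorem PosPair.one_one : PosPair 1 1 := ⟨zero_le_one, zero_le_one, by norm_num⟩

theorem PosPair.one_zero : PosPair 1 0 := ⟨zero_le_one, le_rfl, by norm_num⟩

theorem PosPair.zero_one : PosPair 0 1 := ⟨le_rfl, zero_le_one, by norm_num⟩

/-! ### Coherent sets of options -/

namespace IsCoherentOptions

variable {X : Type*} {D : Set (Gamble X)}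

theorem add_mem (hD : IsCoherentOptions D) {f g : Gamble X} (hf : f ∈ D) (hg : g ∈ D) :
    f + g ∈ D := by
  simpa using hD.cone f hf g hg 1 1 .one_one

theorem smul_mem (hD : IsCoherentOptions D) {f : Gamble X} (hf : f ∈ D) {c : ℝ} (hc : 0 < c) :
    c • f ∈ D := by
  simpa using hD.cone f hf f hf c 0 ⟨hc.le, le_rfl, by simpa using hc⟩

theorem smul_mem_iff (hD : IsCoherentOptions D) {f : Gamble X} {c : ℝ} (hc : 0 < c) :
    c • f ∈ D ↔ f ∈ D := by
  refine ⟨fun h => ?_, fun h => hD.smul_mem h hc⟩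
  simpa [smul_smul, hc.ne'] using hD.smul_mem h (inv_pos.2 hc)

/-- The options that stay desirable after subtraction of some positive constant form an Archimedean
set of desirable options. -/
theorem isArchimedeanOptions_interior [Nonempty X] (hD : IsCoherentOptions D) :
    IsArchimedeanOptions {f | ∃ ε : ℝ, 0 < ε ∧ f - constGamble X ε ∈ D} where
  coherent :=
    { zero_notMem := by
        rintro ⟨ε, hε, h⟩
        refine hD.zero_notMem ?_
        simpa using hD.add_mem h (hD.pos_subset (constGamble_mem_positiveGambles hε))
      pos_subset := fun f hf => by
        obtain ⟨c, hc, h⟩ := exists_le_of_mem_positiveGambles hf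
        refine ⟨c / 2, half_pos hc, hD.pos_subset (mem_positiveGambles_of_le (half_pos hc) ?_)⟩
        intro x
        change c / 2 ≤ f.1 x - c / 2
        linarith [h x]
      cone := by
        rintro f ⟨ε, hε, hf⟩ g ⟨δ, hδ, hg⟩ l m ⟨hl, hm, hlm⟩
        refine ⟨l * ε + m * δ, ?_, ?_⟩
        · rcases hl.eq_or_lt with rfl | hl
          · have : 0 < m := by linarith
            positivity
          · positivity
        · convert hD.cone _ hf _ hg l m ⟨hl, hm, hlm⟩ using 1
          rw [constGamble_add, constGamble_mul, constGamble_mul]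
          module }
  arch := by
    rintro f ⟨ε, hε, hf⟩
    refine ⟨ε / 2, half_pos hε, ε / 2, half_pos hε, ?_⟩
    rwa [sub_sub, ← constGamble_add, add_halves]

open Classical in
theorem isCoherentOptionSets_optionSetsOf (hD : IsCoherentOptions D) :
    IsCoherentOptionSets (optionSetsOf D) where
  erase_zero := by
    rintro A ⟨f, hfA, hf⟩
    exact ⟨f, Finset.mem_erase.2 ⟨fun h => hD.zero_notMem (h ▸ hf), hfA⟩, hf⟩
  zero_notMem := by
    rintro ⟨f, hfA, hf⟩
    exact hD.zero_notMem (Finset.mem_singleton.1 hfA ▸ hf)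
  pos f hf := ⟨f, Finset.mem_singleton_self f, hD.pos_subset hf⟩
  cone := by
    rintro A₁ ⟨f, hfA, hf⟩ A₂ ⟨g, hgA, hg⟩ l m h
    exact ⟨_, Finset.mem_image.2 ⟨(f, g), Finset.mem_product.2 ⟨hfA, hgA⟩, rfl⟩,
      hD.cone f hf g hg _ _ (h f hfA g hgA)⟩
  mono := by
    rintro A₁ ⟨f, hfA, hf⟩ A₂ h
    exact ⟨f, h hfA, hf⟩

end IsCoherentOptions

/-! ### Coherent sets of option sets -/

theorem isCoherentOptionSets_iInter {X ι : Type*} [Nonempty ι] {K : ι → Set (Finset (Gamble X))}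
    (h : ∀ i, IsCoherentOptionSets (K i)) : IsCoherentOptionSets (⋂ i, K i) where
  erase_zero A hA := Set.mem_iInter.2 fun i => (h i).erase_zero A (Set.mem_iInter.1 hA i)
  zero_notMem h0 := ‹Nonempty ι›.elim fun i => (h i).zero_notMem (Set.mem_iInter.1 h0 i)
  pos f hf := Set.mem_iInter.2 fun i => (h i).pos f hf
  cone A₁ h₁ A₂ h₂ l m hlm := Set.mem_iInter.2 fun i =>
    (h i).cone A₁ (Set.mem_iInter.1 h₁ i) A₂ (Set.mem_iInter.1 h₂ i) l m hlm
  mono A₁ h₁ A₂ hA := Set.mem_iInter.2 fun i => (h i).mono A₁ (Set.mem_iInter.1 h₁ i) A₂ hA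

namespace IsCoherentOptionSets

variable {X : Type*} {K : Set (Finset (Gamble X))}

theorem empty_notMem (hK : IsCoherentOptionSets K) : ∅ ∉ K := fun h =>
  hK.zero_notMem (hK.mono _ h _ (Finset.empty_subset _))

theorem mem_of_forall_exists (hK : IsCoherentOptionSets K) {A₁ A₂ A : Finset (Gamble X)}
    (h₁ : A₁ ∈ K) (h₂ : A₂ ∈ K)
    (h : ∀ f ∈ A₁, ∀ g ∈ A₂, ∃ l m : ℝ, PosPair l m ∧ l • f + m • g ∈ A) : A ∈ K := by
  classical
  choose! l m hlm hA using h
  refine hK.mono _ (hK.cone A₁ h₁ A₂ h₂ l m hlm) _ fun v hv => ?_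
  obtain ⟨⟨f, g⟩, hfg, rfl⟩ := Finset.mem_image.1 hv
  obtain ⟨hf, hg⟩ := Finset.mem_product.1 hfg
  exact hA f hf g hg

open Classical in
theorem mem_of_insert_zero_mem (hK : IsCoherentOptionSets K) {A : Finset (Gamble X)}
    (h : insert 0 A ∈ K) : A ∈ K := by
  refine hK.mono _ (hK.erase_zero _ h) _ ?_
  rw [Finset.erase_insert_eq_erase]
  exact Finset.erase_subset _ _

end IsCoherentOptionSets

/-! ### Extension by a single option -/

open Classical in
/-- The option sets whose desirability follows from that of the option sets in `K` and of the
option `g`. -/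
def extendBy {X : Type*} (K : Set (Finset (Gamble X))) (g : Gamble X) :
    Set (Finset (Gamble X)) :=
  {A | ∃ C ∈ K, ∀ c ∈ C, ∃ l m : ℝ, PosPair l m ∧ l • g + m • c ∈ insert 0 A}

theorem subset_extendBy {X : Type*} (K : Set (Finset (Gamble X))) (g : Gamble X) :
    K ⊆ extendBy K g := by
  classical
  exact fun A hA => ⟨A, hA, fun c hc => ⟨0, 1, .zero_one, by simp [hc]⟩⟩

theorem singleton_mem_extendBy {X : Type*} {K : Set (Finset (Gamble X))} (hK : K.Nonempty)
    (g : Gamble X) : {g} ∈ extendBy K g := by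
  classical
  obtain ⟨C, hC⟩ := hK
  exact ⟨C, hC, fun c _ => ⟨1, 0, .one_zero, by simp⟩⟩

theorem extendBy_mono {X : Type*} {K : Set (Finset (Gamble X))} {g : Gamble X}
    {A A' : Finset (Gamble X)} (hA : A ∈ extendBy K g) (h : A ⊆ A') : A' ∈ extendBy K g := by
  classical
  obtain ⟨C, hC, hCA⟩ := hA
  refine ⟨C, hC, fun c hc => ?_⟩
  obtain ⟨l, m, hlm, hmem⟩ := hCA c hc
  exact ⟨l, m, hlm, Finset.insert_subset_insert 0 h hmem⟩

/-- If some option set is not in the extension, then the extension is coherent. -/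
theorem IsCoherentOptionSets.isCoherentOptionSets_extendBy {X : Type*} {K : Set (Finset (Gamble X))}
    (hK : IsCoherentOptionSets K) {g : Gamble X} {B : Finset (Gamble X)}
    (hB : B ∉ extendBy K g) : IsCoherentOptionSets (extendBy K g) := by
  classical
  have erase_zero : ∀ A ∈ extendBy K g, A.erase 0 ∈ extendBy K g := by
    rintro A ⟨C, hC, hCA⟩
    refine ⟨C, hC, fun c hc => ?_⟩
    obtain ⟨l, m, hlm, hmem⟩ := hCA c hc
    refine ⟨l, m, hlm, ?_⟩
    simp only [Finset.mem_insert, Finset.mem_erase] at hmem ⊢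
    tauto
  refine ⟨fun A hA => by convert erase_zero A hA, fun h => hB ?_,
    fun f hf => subset_extendBy K g (hK.pos f hf), ?_,
    fun A₁ h₁ A₂ h => extendBy_mono h₁ h⟩
  -- Erasing 0 from `{0}` would put `∅`, and by monotonicity `B`, into the extension.
  · refine extendBy_mono (erase_zero _ h) ?_
    simp
  · rintro A₁ ⟨C₁, hC₁, h₁⟩ A₂ ⟨C₂, hC₂, h₂⟩ l m hlm
    set A := (A₁ ×ˢ A₂).image (fun p => l p.1 p.2 • p.1 + m p.1 p.2 • p.2)
    -- A combination of `l₁ g + m₁ c₁` and `l₂ g + m₂ c₂` is regrouped as a multiple of `g` plus a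
    -- combination of `c₁` and `c₂`, to which the cone axiom of `K` applies.
    have key : ∀ c₁ ∈ C₁, ∀ c₂ ∈ C₂, ∃ a b : ℝ, PosPair a b ∧ ∃ s t : ℝ, PosPair s t ∧
        s • g + t • (a • c₁ + b • c₂) ∈ insert 0 A := by
      intro c₁ hc₁ c₂ hc₂
      obtain ⟨l₁, m₁, p₁, q₁⟩ := h₁ c₁ hc₁
      obtain ⟨l₂, m₂, p₂, q₂⟩ := h₂ c₂ hc₂
      rcases Finset.mem_insert.1 q₁ with q₁ | q₁
      · exact ⟨1, 0, .one_zero, l₁, m₁, p₁, by simp [q₁]⟩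
      rcases Finset.mem_insert.1 q₂ with q₂ | q₂
      · exact ⟨0, 1, .zero_one, l₂, m₂, p₂, by simp [q₂]⟩
      have hmem : l (l₁ • g + m₁ • c₁) (l₂ • g + m₂ • c₂) • (l₁ • g + m₁ • c₁) +
          m (l₁ • g + m₁ • c₁) (l₂ • g + m₂ • c₂) • (l₂ • g + m₂ • c₂) ∈ A :=
        Finset.mem_image.2 ⟨(_, _), Finset.mem_product.2 ⟨q₁, q₂⟩, rfl⟩
      obtain ⟨ha, hb, hab⟩ := hlm _ q₁ _ q₂
      generalize l (l₁ • g + m₁ • c₁) (l₂ • g + m₂ • c₂) = a at *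
      generalize m (l₁ • g + m₁ • c₁) (l₂ • g + m₂ • c₂) = b at *
      obtain ⟨hl₁, hm₁, hlm₁⟩ := p₁
      obtain ⟨hl₂, hm₂, hlm₂⟩ := p₂
      have e₁ : 0 ≤ a * m₁ := mul_nonneg ha hm₁
      have e₂ : 0 ≤ b * m₂ := mul_nonneg hb hm₂
      have e₃ : 0 ≤ a * l₁ := mul_nonneg ha hl₁
      have e₄ : 0 ≤ b * l₂ := mul_nonneg hb hl₂
      -- If `c₁` and `c₂` both get coefficient 0, only a positive multiple of `g` remains; the pair
      -- `(1, 0)` is then a dummy, annihilated by `t = 0`.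
      rcases (add_nonneg e₁ e₂).eq_or_lt with h0 | h0
      · refine ⟨1, 0, .one_zero, a * l₁ + b * l₂, 0, ⟨by positivity, le_rfl, ?_⟩, ?_⟩
        · have : 0 < a * (l₁ + m₁) + b * (l₂ + m₂) := by
            rcases ha.eq_or_lt with rfl | ha
            · have : 0 < b := by linarith
              positivity
            · positivity
          linarith
        · refine Finset.mem_insert_of_mem ?_
          convert hmem using 1
          have z₁ : a * m₁ = 0 := by linarith
          have z₂ : b * m₂ = 0 := by linarith
          simp only [smul_add, smul_smul, z₁, z₂]
          module
      · refine ⟨a * m₁, b * m₂, ⟨e₁, e₂, h0⟩, a * l₁ + b * l₂, 1,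
          ⟨by positivity, zero_le_one, by positivity⟩, Finset.mem_insert_of_mem ?_⟩
        convert hmem using 1
        module
    choose! a b hab hst using key
    refine ⟨_, hK.cone C₁ hC₁ C₂ hC₂ a b hab, fun c hc => ?_⟩
    obtain ⟨⟨c₁, c₂⟩, hp, rfl⟩ := Finset.mem_image.1 hc
    obtain ⟨hc₁, hc₂⟩ := Finset.mem_product.1 hp
    convert hst c₁ hc₁ c₂ hc₂

/-- If `A ∈ K` and `B` belongs to every extension of `K` by an element of `A`, then `B ∈ K`. -/
theorem IsCoherentOptionSets.mem_of_forall_mem_extendBy {X : Type*} {K : Set (Finset (Gamble X))}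
    (hK : IsCoherentOptionSets K) {A B : Finset (Gamble X)} (hA : A ∈ K)
    (h : ∀ f ∈ A, B ∈ extendBy K f) : B ∈ K := by
  classical
  -- Elements of `S` are eliminated one at a time: `f` is combined with the `C` witnessing `B ∈
  -- extendBy K f`, which lands in `insert 0 B`, and every other element is kept by the pair `(1,
  -- 0)`.
  have key : ∀ S : Finset (Gamble X), S ⊆ A → S ∪ insert 0 B ∈ K → insert 0 B ∈ K := by
    intro S
    induction S using Finset.induction_on with
    | empty => exact fun _ hS => by simpa using hS
    | insert f S _ ih =>
      intro hSA hS
      rw [Finset.insert_subset_iff] at hSA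
      obtain ⟨C, hC, hCB⟩ := h f hSA.1
      refine ih hSA.2 (hK.mem_of_forall_exists hS hC fun f' hf' c hc => ?_)
      by_cases hff : f' = f
      · obtain ⟨l, m, hlm, hmem⟩ := hCB c hc
        exact ⟨l, m, hlm, Finset.mem_union_right _ (hff ▸ hmem)⟩
      · refine ⟨1, 0, .one_zero, ?_⟩
        rw [Finset.insert_union, Finset.mem_insert] at hf'
        simpa using hf'.resolve_left hff
  exact hK.mem_of_insert_zero_mem
    (key A subset_rfl (hK.mono A hA _ Finset.subset_union_left))

/-! ### Separation by a set of options -/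

theorem IsCoherentOptionSets.sUnion {X : Type*} {c : Set (Set (Finset (Gamble X)))}
    (hc : IsChain (· ⊆ ·) c) (hne : c.Nonempty) (h : ∀ K ∈ c, IsCoherentOptionSets K) :
    IsCoherentOptionSets (⋃₀ c) where
  erase_zero := by
    rintro A ⟨K, hKc, hA⟩
    exact ⟨K, hKc, (h K hKc).erase_zero A hA⟩
  zero_notMem := by
    rintro ⟨K, hKc, hA⟩
    exact (h K hKc).zero_notMem hA
  pos f hf := hne.elim fun K hK => ⟨K, hK, (h K hK).pos f hf⟩
  cone := by
    rintro A₁ ⟨K₁, hK₁, h₁⟩ A₂ ⟨K₂, hK₂, h₂⟩ l m hlm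
    rcases hc.total hK₁ hK₂ with h12 | h12
    · exact ⟨K₂, hK₂, (h K₂ hK₂).cone A₁ (h12 h₁) A₂ h₂ l m hlm⟩
    · exact ⟨K₁, hK₁, (h K₁ hK₁).cone A₁ h₁ A₂ (h12 h₂) l m hlm⟩
  mono := by
    rintro A₁ ⟨K, hKc, hA⟩ A₂ h12
    exact ⟨K, hKc, (h K hKc).mono A₁ hA A₂ h12⟩

/-- An option set outside a coherent `K` is separated from `K` by a coherent set of options. -/
theorem IsCoherentOptionSets.exists_isCoherentOptions {X : Type*} [Nonempty X]
    {K : Set (Finset (Gamble X))} (hK : IsCoherentOptionSets K) {B : Finset (Gamble X)}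
    (hB : B ∉ K) : ∃ D : Set (Gamble X), IsCoherentOptions D ∧ K ⊆ optionSetsOf D ∧
      B ∉ optionSetsOf D := by
  classical
  obtain ⟨M, hKM, hM⟩ := zorn_subset_nonempty
    {K' : Set (Finset (Gamble X)) | IsCoherentOptionSets K' ∧ B ∉ K'}
    (fun c hcS hc hne => ⟨⋃₀ c, ⟨.sUnion hc hne fun K' h => (hcS h).1,
      fun ⟨K', h, hB'⟩ => (hcS h).2 hB'⟩, fun s hs => Set.subset_sUnion_of_mem hs⟩) K ⟨hK, hB⟩
  obtain ⟨hMc, hMB⟩ := hM.prop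
  refine ⟨{f | ({f} : Finset (Gamble X)) ∈ M}, ⟨hMc.zero_notMem, hMc.pos, fun f hf g hg l m hlm => ?_⟩, ?_, ?_⟩
  · refine hMc.mem_of_forall_exists hf hg fun f' hf' g' hg' => ⟨l, m, hlm, ?_⟩
    rw [Finset.mem_singleton.1 hf', Finset.mem_singleton.1 hg', Finset.mem_singleton]
  · intro A hA
    by_contra hn
    refine hMB (hMc.mem_of_forall_mem_extendBy (hKM hA) fun f hf => ?_)
    by_contra hBf
    have hle : extendBy M f ⊆ M :=
      hM.le_of_ge (y := extendBy M f) ⟨hMc.isCoherentOptionSets_extendBy hBf, hBf⟩ (subset_extendBy M f)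
    exact hn ⟨f, hf, hle (singleton_mem_extendBy ⟨A, hKM hA⟩ f)⟩
  · rintro ⟨f, hfB, hf⟩
    exact hMB (hMc.mono _ hf _ (Finset.singleton_subset_iff.2 hfB))

/-- An option set outside an Archimedean `K` is separated from `K` by an Archimedean set of
options. -/
theorem IsArchimedeanOptionSets.exists_archimedeanOptions {X : Type*} [Nonempty X]
    {K : Set (Finset (Gamble X))} (hK : IsArchimedeanOptionSets K) {B : Finset (Gamble X)}
    (hB : B ∉ K) : ∃ D : ArchimedeanOptions X, K ⊆ optionSetsOf D.carrier ∧
      B ∉ optionSetsOf D.carrier := by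
  classical
  obtain ⟨D, hD, hKD, hBD⟩ := hK.coherent.exists_isCoherentOptions hB
  refine ⟨⟨_, hD.isArchimedeanOptions_interior⟩, fun A hA => ?_, ?_⟩
  · obtain ⟨ε, hε, hAε⟩ := hK.arch A hA
    obtain ⟨_, hf', hf⟩ := hKD hAε
    obtain ⟨f, hfA, rfl⟩ := Finset.mem_image.1 hf'
    exact ⟨f, hfA, ε, hε, hf⟩
  · rintro ⟨f, hfB, ε, hε, hf⟩
    refine hBD ⟨f, hfB, ?_⟩
    simpa using hD.add_mem hf (hD.pos_subset (constGamble_mem_positiveGambles hε))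

/-! ### Coherent lower previsions -/

/-- A coherent lower prevision: a superlinear functional that dominates the infimum. -/
structure IsCoherentLowerPrevision {X : Type*} (P : Gamble X → ℝ) : Prop where
  le_of_forall_le : ∀ f : Gamble X, ∀ c : ℝ, (∀ x, c ≤ f.1 x) → c ≤ P f
  add_le : ∀ f g : Gamble X, P f + P g ≤ P (f + g)
  smul : ∀ f : Gamble X, ∀ c : ℝ, 0 < c → P (c • f) = c * P f

theorem isClosed_setOf_isCoherentLowerPrevision (X : Type*) :
    IsClosed {P : Gamble X → ℝ | IsCoherentLowerPrevision P} := by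
  have : {P : Gamble X → ℝ | IsCoherentLowerPrevision P} =
      {P | ∀ f : Gamble X, ∀ c : ℝ, (∀ x, c ≤ f.1 x) → c ≤ P f} ∩
      {P | ∀ f g : Gamble X, P f + P g ≤ P (f + g)} ∩
      {P | ∀ f : Gamble X, ∀ c : ℝ, 0 < c → P (c • f) = c * P f} :=
    Set.ext fun P => ⟨fun h => ⟨⟨h.1, h.2⟩, h.3⟩, fun h => ⟨h.1.1, h.1.2, h.2⟩⟩
  rw [this]
  simp only [Set.ofPred_forall]
  refine (IsClosed.inter ?_ ?_).inter ?_
  · exact isClosed_iInter fun f => isClosed_iInter fun c => isClosed_iInter fun _ =>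
      isClosed_le continuous_const (continuous_apply f)
  · exact isClosed_iInter fun f => isClosed_iInter fun g =>
      isClosed_le (by fun_prop) (continuous_apply _)
  · exact isClosed_iInter fun f => isClosed_iInter fun c => isClosed_iInter fun _ =>
      isClosed_eq (continuous_apply _) (by fun_prop)

namespace IsCoherentLowerPrevision

variable {X : Type*} {P : Gamble X → ℝ}

theorem map_zero (hP : IsCoherentLowerPrevision P) : P 0 = 0 := by
  have := hP.smul 0 2 two_pos
  rw [smul_zero] at this
  linarith

theorem le_of_forall_ge (hP : IsCoherentLowerPrevision P) {f : Gamble X} {c : ℝ}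
    (h : ∀ x, f.1 x ≤ c) : P f ≤ c := by
  have h₁ := hP.add_le f (-f)
  have h₂ := hP.le_of_forall_le (-f) (-c) fun x => neg_le_neg (h x)
  rw [add_neg_cancel, hP.map_zero] at h₁
  linarith

/-- Superadditivity for `f` and `-c` gives one inequality, for `f - c` and `c` the other. -/
theorem map_sub_const (hP : IsCoherentLowerPrevision P) (f : Gamble X) (c : ℝ) :
    P (f - constGamble X c) = P f - c := by
  have h₁ := hP.add_le f (constGamble X (-c))
  have h₂ := hP.add_le (f - constGamble X c) (constGamble X c)
  have h₃ := hP.le_of_forall_le (constGamble X (-c)) (-c) fun _ => le_rfl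
  have h₄ := hP.le_of_forall_le (constGamble X c) c fun _ => le_rfl
  rw [sub_add_cancel] at h₂
  have h₅ : f + constGamble X (-c) = f - constGamble X c :=
    (sub_eq_add_neg f (constGamble X c)).symm
  rw [h₅] at h₁
  linarith

theorem isArchimedeanOptions (hP : IsCoherentLowerPrevision P) :
    IsArchimedeanOptions {f | 0 < P f} where
  coherent :=
    { zero_notMem := fun h => h.ne' hP.map_zero
      pos_subset := fun f hf => by
        obtain ⟨c, hc, h⟩ := exists_le_of_mem_positiveGambles hf
        exact hc.trans_le (hP.le_of_forall_le f c h)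
      cone := by
        rintro f (hf : 0 < P f) g (hg : 0 < P g) l m ⟨hl, hm, hlm⟩
        change 0 < P _
        rcases hl.eq_or_lt with rfl | hl
        · have hm : 0 < m := by linarith
          rw [zero_smul, zero_add, hP.smul _ _ hm]
          positivity
        rcases hm.eq_or_lt with rfl | hm
        · rw [zero_smul, add_zero, hP.smul _ _ hl]
          positivity
        refine lt_of_lt_of_le ?_ (hP.add_le _ _)
        rw [hP.smul _ _ hl, hP.smul _ _ hm]
        positivity }
  arch f hf := ⟨P f / 2, half_pos hf, by
    change 0 < P _
    rw [hP.map_sub_const]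
    linarith [show 0 < P f from hf]⟩

theorem lowerPrevision_eq (hP : IsCoherentLowerPrevision P) : lowerPrevision {f | 0 < P f} = P := by
  funext f
  have : {μ : ℝ | f - constGamble X μ ∈ {f | 0 < P f}} = Set.Iio (P f) := by
    ext μ
    simp [hP.map_sub_const]
  rw [lowerPrevision, this, csSup_Iio]

end IsCoherentLowerPrevision

/-! ### From Archimedean sets to lower previsions -/

namespace IsArchimedeanOptions

variable {X : Type*} [Nonempty X] {D : Set (Gamble X)}

/-- The Archimedean axiom prevents the supremum from being attained, whence the strict inequality.
With `c = 0`, `D` is recovered from its lower prevision. -/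
theorem lt_lowerPrevision_iff (hD : IsArchimedeanOptions D) {f : Gamble X} {c : ℝ} :
    c < lowerPrevision D f ↔ f - constGamble X c ∈ D := by
  have hlub := isLUB_lowerPrevision hD f
  constructor
  · intro h
    obtain ⟨μ, hμ, hcμ⟩ := (lt_isLUB_iff hlub).1 h
    have := hD.coherent.add_mem hμ
      (hD.coherent.pos_subset (constGamble_mem_positiveGambles (sub_pos.2 hcμ)))
    simpa [constGamble_sub] using this
  · intro h
    obtain ⟨ε, hε, hf⟩ := hD.arch _ h
    rw [sub_sub, ← constGamble_add] at hf
    exact lt_of_lt_of_le (lt_add_of_pos_right c hε) (hlub.1 hf)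

theorem lowerPrevision_pos_iff (hD : IsArchimedeanOptions D) {f : Gamble X} :
    0 < lowerPrevision D f ↔ f ∈ D := by
  rw [hD.lt_lowerPrevision_iff, constGamble_zero, sub_zero]

theorem isCoherentLowerPrevision (hD : IsArchimedeanOptions D) :
    IsCoherentLowerPrevision (lowerPrevision D) where
  le_of_forall_le f c h := by
    refine le_of_forall_lt fun a ha => hD.lt_lowerPrevision_iff.2 (hD.coherent.pos_subset
      (mem_positiveGambles_of_le (sub_pos.2 ha) fun x => ?_))
    exact sub_le_sub_right (h x) a
  add_le f g := by
    refine le_of_forall_lt fun a ha => hD.lt_lowerPrevision_iff.2 ?_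
    have hf : lowerPrevision D f - (lowerPrevision D f + lowerPrevision D g - a) / 2 <
        lowerPrevision D f := by linarith
    have hg : lowerPrevision D g - (lowerPrevision D f + lowerPrevision D g - a) / 2 <
        lowerPrevision D g := by linarith
    have := hD.coherent.add_mem (hD.lt_lowerPrevision_iff.1 hf) (hD.lt_lowerPrevision_iff.1 hg)
    rw [sub_add_sub_comm, ← constGamble_add] at this
    convert this using 3
    ring
  smul f c hc := by
    refine eq_of_forall_lt_iff fun a => ?_
    rw [hD.lt_lowerPrevision_iff, ← div_lt_iff₀' hc, hD.lt_lowerPrevision_iff,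
      ← hD.coherent.smul_mem_iff hc (f := f - _), smul_sub, ← constGamble_mul,
      mul_div_cancel₀ _ hc.ne']

end IsArchimedeanOptions

/-! ### Compactness of the space of Archimedean sets -/

namespace ArchimedeanOptions

variable {X : Type*}

theorem isInducing_lowerPrevision :
    Topology.IsInducing fun D : ArchimedeanOptions X => lowerPrevision D.carrier := ⟨rfl⟩

theorem continuous_lowerPrevision (f : Gamble X) :
    Continuous fun D : ArchimedeanOptions X => lowerPrevision D.carrier f :=
  (continuous_apply f).comp isInducing_lowerPrevision.continuous

theorem range_lowerPrevision [Nonempty X] :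
    Set.range (fun D : ArchimedeanOptions X => lowerPrevision D.carrier) =
      {P | IsCoherentLowerPrevision P} := by
  ext P
  constructor
  · rintro ⟨D, rfl⟩
    exact D.isArchimedean.isCoherentLowerPrevision
  · intro hP
    exact ⟨⟨_, hP.isArchimedeanOptions⟩, hP.lowerPrevision_eq⟩

instance compactSpace [Nonempty X] : CompactSpace (ArchimedeanOptions X) := by
  refine ⟨isInducing_lowerPrevision.isCompact_iff.2 ?_⟩
  rw [Set.image_univ, range_lowerPrevision]
  choose C hC using fun f : Gamble X => f.2
  refine (isCompact_univ_pi fun f => isCompact_Icc (a := -C f) (b := C f)).of_isClosed_subset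
    (isClosed_setOf_isCoherentLowerPrevision X) fun P hP f _ => ?_
  exact ⟨hP.le_of_forall_le f _ fun x => (abs_le.1 (hC f x)).1,
    hP.le_of_forall_ge fun x => (abs_le.1 (hC f x)).2⟩

end ArchimedeanOptions

/-! ### Closed representations -/

theorem isArchimedeanOptionSets_of_isClosedRepresentation {X : Type*} [Nonempty X]
    {K : Set (Finset (Gamble X))} {𝒟 : Set (ArchimedeanOptions X)}
    (h : IsClosedRepresentation K 𝒟) : IsArchimedeanOptionSets K := by
  classical
  obtain ⟨hne, hcl, rfl⟩ := h
  have := hne.to_subtype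
  refine ⟨?_, fun A hA => ?_⟩
  · rw [Set.biInter_eq_iInter]
    exact isCoherentOptionSets_iInter fun D : 𝒟 =>
      D.1.isArchimedean.coherent.isCoherentOptionSets_optionSetsOf
  · rw [Set.mem_iInter₂] at hA
    have hAne : A.Nonempty := by
      obtain ⟨D, hD⟩ := hne
      obtain ⟨f, hf, -⟩ := hA D hD
      exact ⟨f, hf⟩
    obtain ⟨E, hE, hmin⟩ := hcl.isCompact.exists_isMinOn hne
      (f := fun D => A.sup' hAne fun f => lowerPrevision D.carrier f)
      (Continuous.finset_sup'_apply hAne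
        fun f _ => ArchimedeanOptions.continuous_lowerPrevision f).continuousOn
    set δ := A.sup' hAne fun f => lowerPrevision E.carrier f
    have hδpos : 0 < δ := by
      obtain ⟨f, hfA, hf⟩ := hA E hE
      exact (Finset.lt_sup'_iff hAne).2 ⟨f, hfA, E.isArchimedean.lowerPrevision_pos_iff.2 hf⟩
    refine ⟨δ / 2, half_pos hδpos, Set.mem_iInter₂.2 fun D hD => ?_⟩
    have hlt : δ / 2 < A.sup' hAne fun f => lowerPrevision D.carrier f :=
      (half_lt_self hδpos).trans_le (hmin hD)
    obtain ⟨f, hfA, hf⟩ := (Finset.lt_sup'_iff hAne).1 hlt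
    exact ⟨_, Finset.mem_image_of_mem _ hfA, D.isArchimedean.lt_lowerPrevision_iff.1 hf⟩

/-- Since `A - ε ∈ K` as well, the open condition `P_D(f) > 0` for some `f ∈ A` can be replaced by
the closed one `P_D(f) ≥ ε`; finiteness of `A` keeps the union over `f` closed. -/
theorem IsArchimedeanOptionSets.isClosed {X : Type*} [Nonempty X] {K : Set (Finset (Gamble X))}
    (hK : IsArchimedeanOptionSets K) :
    IsClosed {D : ArchimedeanOptions X | K ⊆ optionSetsOf D.carrier} := by
  classical
  choose! ε hε hA using hK.arch
  have : {D : ArchimedeanOptions X | K ⊆ optionSetsOf D.carrier} =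
      ⋂ A ∈ K, ⋃ f ∈ A, {D : ArchimedeanOptions X | ε A ≤ lowerPrevision D.carrier f} := by
    ext D
    simp only [Set.mem_iInter, Set.mem_iUnion, Set.mem_ofPred_eq, exists_prop]
    constructor
    · intro h A hAK
      obtain ⟨_, hf', hf⟩ := h (hA A hAK)
      obtain ⟨f, hfA, rfl⟩ := Finset.mem_image.1 hf'
      exact ⟨f, hfA, (D.isArchimedean.lt_lowerPrevision_iff.2 hf).le⟩
    · intro h A hAK
      obtain ⟨f, hfA, hf⟩ := h A hAK
      exact ⟨f, hfA, D.isArchimedean.lowerPrevision_pos_iff.1 ((hε A hAK).trans_le hf)⟩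
  rw [this]
  exact isClosed_biInter fun A _ => A.finite_toSet.isClosed_biUnion fun f _ =>
    isClosed_le continuous_const (ArchimedeanOptions.continuous_lowerPrevision f)

theorem IsArchimedeanOptionSets.isClosedRepresentation {X : Type*} [Nonempty X]
    {K : Set (Finset (Gamble X))} (hK : IsArchimedeanOptionSets K) :
    IsClosedRepresentation K {D : ArchimedeanOptions X | K ⊆ optionSetsOf D.carrier} := by
  refine ⟨?_, hK.isClosed, ?_⟩
  -- Separating `∅`, which no coherent `K` contains, already yields a member of the family.
  · obtain ⟨D, hD, -⟩ := hK.exists_archimedeanOptions hK.coherent.empty_notMem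
    exact ⟨D, hD⟩
  · refine Set.Subset.antisymm (Set.subset_iInter₂ fun D hD => hD) fun B hB => ?_
    by_contra hBK
    obtain ⟨D, hKD, hBD⟩ := hK.exists_archimedeanOptions hBK
    exact hBD (Set.mem_iInter₂.1 hB D hKD)

theorem mainTheorem4 {X : Type*} [Nonempty X] (K : Set (Finset (Gamble X))) :
    (IsArchimedeanOptionSets K ↔
      ∃ 𝒟 : Set (ArchimedeanOptions X), IsClosedRepresentation K 𝒟) ∧
    (IsArchimedeanOptionSets K →
      IsGreatest {𝒟 : Set (ArchimedeanOptions X) | IsClosedRepresentation K 𝒟}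
        {D : ArchimedeanOptions X | K ⊆ optionSetsOf D.carrier}) := by
  refine ⟨⟨fun hK => ⟨_, hK.isClosedRepresentation⟩,
    fun ⟨_, h⟩ => isArchimedeanOptionSets_of_isClosedRepresentation h⟩,
    fun hK => ⟨hK.isClosedRepresentation, ?_⟩⟩
  rintro 𝒟 ⟨-, -, rfl⟩ D hD
  exact Set.biInter_subset_of_mem hD
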